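/- Let $K$ be a pathwise connected poset and let $\mathcal X=(X,p,J,K)$ be a net bundle of topological spaces over $K$: a family of topological spaces $X_a$ ($a\in K$) with disjoint union $X$, projection $p:X\to K$, and homeomorphisms $J_{(b,a)}:X_a\to X_b$ for $a\le b$ with $J_{(a,a)}=\mathrm{id}$ and $J_{(c,b)}J_{(b,a)}=J_{(c,a)}$. Suppose its fibres are homeomorphic to a path-connected space $M$. Let $\tau K$ be $K$ with the Alexandroff topology, whose base consists of the sets $V_a=\{o\in K: a\le o\}$, and let $\tau X$ be $X$ with the topology generated by the cylinders $T_{a,W}=\bigcup_{o\ge a}J_{(o,a)}(W)$, with $a\in K$ and $W\subseteq X_a$ open. Then: (1) $p:\tau X\to\tau K$ is a fibre bundle with fibre $M$ (and $\tau X$ induces on each fibre $X_a$ its given topology). Suppose moreover that for each $a\in K$ a base $X_{\prec,a}$ of the topology of $X_a$ is given, consisting of arcwise connected and simply connected (in particular non-empty) open sets, such that every $J_{(b,a)}$ maps $X_{\prec,a}$ bijectively onto $X_{\prec,b}$. Let $X_{\circ,\prec}$ be the associated poset of the dual net bundle (the net bundle over the dual poset $K^\circ$ with net structure given by the maps $J^{-1}$):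 its elements are the pairs $(a,W)$ with $a\in K$ and $W\in X_{\prec,a}$, and $(a,W)\prec(a',W')$ means that $a'\le a$ and $J_{(a,a')}^{-1}(W)\subseteq W'$. For a poset $P$, let $\tilde\Sigma_*(P)$ be its symmetric simplicial set: a 1-simplex consists of two vertices and a support above both; a 2-simplex consists of three compatible faces and a support above their supports. Let $\pi_1(P,u)$ be the group of closed paths of 1-simplices at $u$ modulo the elementary deformations given by 2-simplices ($\partial_0c*\partial_2c\sim\partial_1c$). For a group $G$ let $H^1(P,G)$ be the set of maps $z$ from 1-simplices to $G$ with $z(\partial_0c)z(\partial_2c)=z(\partial_1c)$ for all 2-simplices $c$, modulo the relation $z\sim z'$ if there is $f:P\to G$ with $f(\partial_0b)z(b)=z'(b)f(\partial_1b)$ for all 1-simplices $b$. Then for every $U\in X_{\circ,\prec}$ and every $x\in\tau X$: (2) there is an isomorphism of groups $\varphi:\pi_1(X_{\circ,\prec},U)\to\pi_1(\tau X,x)$; (3) $\varphi$ can be chosen so that for every group $G$ the assignment $[z]\mapsto[z\circ\varphi^{-1}]$, where $z$ is extended to paths by $z(b_n*\cdots*b_1)=z(b_n)\cdots z(b_1)$,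 is a well-defined bijection $$H^1(X_{\circ,\prec},G)\;\cong\;\mathrm{Hom}(\pi_1(\tau X,x),G)/\!\sim,$$ where two morphisms are equivalent if they differ by an inner automorphism of $G$. -/

import Mathlib

open Set Topology Bundle

universe u v w t

/-! ### Paths and homotopy in the symmetric simplicial set of a poset -/

section PosetHomotopy

/-- A 1-simplex `(o; b, a)` of the symmetric simplicial set of `K`, with initial vertex `a`
(the 1-face), final vertex `b` (the 0-face) and support `o ≥ a, b`. -/
structure OneSimplex {K : Type u} [PartialOrder K] (a b : K) : Type u where
  supp : K
  start_le : a ≤ supp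
  end_le : b ≤ supp

/-- A 2-simplex with vertices `x, y, z`: three 1-simplices (the face `dᵢ` is opposite to the
`i`-th vertex) and a support that lies above the supports of the faces. -/
structure TwoSimplex {K : Type u} [PartialOrder K] (x y z : K) : Type u where
  d0 : OneSimplex y z
  d1 : OneSimplex x z
  d2 : OneSimplex x y
  supp : K
  d0_le : d0.supp ≤ supp
  d1_le : d1.supp ≤ supp
  d2_le : d2.supp ≤ supp

variable {K : Type u} [PartialOrder K]

/-- The degenerate 1-simplex `(a; a, a)`. -/
def OneSimplex.degen (a : K) : OneSimplex a a := ⟨a, le_rfl, le_rfl⟩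

/-- The reverse of a 1-simplex. -/
def OneSimplex.rev {a b : K} (s : OneSimplex a b) : OneSimplex b a := ⟨s.supp, s.end_le, s.start_le⟩

/-- Paths from `a` to `b`: finite non-empty composable sequences `bₙ * ⋯ * b₁` of 1-simplices;
`p.snoc s` is `s * p`. -/
inductive PosetPath {K : Type u} [PartialOrder K] : K → K → Type u
  | single {a b : K} (s : OneSimplex a b) : PosetPath a b
  | snoc {a b c : K} (p : PosetPath a b) (s : OneSimplex b c) : PosetPath a c

namespace PosetPath

/-- Concatenation `p * q`: first `q`, then `p`. -/
def comp {a b c : K} (p : PosetPath b c) (q : PosetPath a b) : PosetPath a c :=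
  match p with
  | single s => q.snoc s
  | snoc p s => (comp p q).snoc s

/-- The reverse path. -/
def rev {a b : K} (p : PosetPath a b) : PosetPath b a :=
  match p with
  | single s => single s.rev
  | snoc p s => (rev p).comp (single s.rev)

/-- Elementary contractions: a consecutive pair `∂₀c * ∂₂c` occurring in a path is replaced
by `∂₁c`. -/
inductive Contracts {K : Type u} [PartialOrder K] :
    {a b : K} → PosetPath a b → PosetPath a b → Prop
  | first {x y z : K} (c : TwoSimplex x y z) :
      Contracts ((single c.d2).snoc c.d0) (single c.d1)
  | last {a x y z : K} (q : PosetPath a x) (c : TwoSimplex x y z) :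
      Contracts ((q.snoc c.d2).snoc c.d0) (q.snoc c.d1)
  | snoc {a b c : K} {p p' : PosetPath a b} (h : Contracts p p') (s : OneSimplex b c) :
      Contracts (p.snoc s) (p'.snoc s)

/-- Homotopy of paths: the equivalence relation generated by elementary deformations
(contractions and their inverses). -/
def homotopic (a b : K) : Setoid (PosetPath a b) := Relation.EqvGen.setoid Contracts

theorem comp_assoc {a b c d : K} (p : PosetPath c d) (q : PosetPath b c) (r : PosetPath a b) :
    (p.comp q).comp r = p.comp (q.comp r) := by
  induction p with
  | single s => rfl
  | snoc p s ih => simp only [comp, ih]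

theorem Contracts.comp_left {a b c : K} (p : PosetPath b c) {q q' : PosetPath a b}
    (h : Contracts q q') : Contracts (p.comp q) (p.comp q') := by
  induction p with
  | single s => exact h.snoc s
  | snoc p s ih => exact ih.snoc s

theorem Contracts.comp_right {a b c : K} {p p' : PosetPath b c} (h : Contracts p p')
    (q : PosetPath a b) : Contracts (p.comp q) (p'.comp q) := by
  induction h with
  | first c => exact Contracts.last q c
  | last r c => exact Contracts.last (r.comp q) c
  | snoc h s ih => exact ih.snoc s

theorem homotopic_map {a b c d : K} (f : PosetPath a b → PosetPath c d)
    (hf : ∀ p q, Contracts p q → Contracts (f p) (f q)) {p q : PosetPath a b}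
    (h : homotopic a b p q) : homotopic c d (f p) (f q) := by
  induction h with
  | rel x y h => exact .rel _ _ (hf _ _ h)
  | refl x => exact .refl _
  | symm x y _ ih => exact .symm _ _ ih
  | trans x y z _ _ ih1 ih2 => exact .trans _ _ _ ih1 ih2

theorem homotopic_comp {a b c : K} {p p' : PosetPath b c} {q q' : PosetPath a b}
    (hp : homotopic b c p p') (hq : homotopic a b q q') :
    homotopic a c (p.comp q) (p'.comp q') :=
  (homotopic a c).trans (homotopic_map (fun r => r.comp q) (fun _ _ h => h.comp_right q) hp)
    (homotopic_map (fun r => p'.comp r) (fun _ _ h => h.comp_left p') hq)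

theorem comp_degen {a b : K} (p : PosetPath a b) :
    Contracts (p.comp (single (OneSimplex.degen a))) p := by
  induction p with
  | single s =>
    exact Contracts.first ⟨s, s, OneSimplex.degen _, s.supp, le_rfl, le_rfl, s.start_le⟩
  | snoc p s ih => exact ih.snoc s

theorem degen_comp {a b : K} (p : PosetPath a b) :
    Contracts ((single (OneSimplex.degen b)).comp p) p := by
  cases p with
  | single s =>
    exact Contracts.first ⟨OneSimplex.degen _, s, s, s.supp, s.end_le, le_rfl, le_rfl⟩
  | snoc q s =>
    exact Contracts.last q ⟨OneSimplex.degen _, s, s, s.supp, s.end_le, le_rfl, le_rfl⟩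

theorem rev_comp {a b : K} (p : PosetPath a b) :
    homotopic a a (p.rev.comp p) (single (OneSimplex.degen a)) := by
  induction p with
  | single s =>
    exact .rel _ _ (Contracts.first
      ⟨s.rev, OneSimplex.degen _, s, s.supp, le_rfl, s.start_le, le_rfl⟩)
  | @snoc b c p s ih =>
    have h1 : Contracts ((p.snoc s).snoc s.rev) (p.snoc (OneSimplex.degen b)) :=
      Contracts.last p ⟨s.rev, OneSimplex.degen _, s, s.supp, le_rfl, s.start_le, le_rfl⟩
    have h2 : Contracts (p.snoc (OneSimplex.degen b)) p := degen_comp p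
    have h3 : ((p.snoc s).rev).comp (p.snoc s) = p.rev.comp ((p.snoc s).snoc s.rev) := by
      rw [rev, comp_assoc]; rfl
    rw [h3]
    exact (homotopic a a).trans
      ((homotopic a a).trans (.rel _ _ (h1.comp_left p.rev)) (.rel _ _ (h2.comp_left p.rev))) ih

end PosetPath

/-- A poset is pathwise connected if any two elements are joined by a path. -/
def PosetPathConnected (K : Type u) [PartialOrder K] : Prop :=
  ∀ a b : K, Nonempty (PosetPath a b)

/-- The homotopy group `π₁(K, a)` of a poset: homotopy classes of closed paths. -/
def PosetPi1 (a : K) : Type u := Quotient (PosetPath.homotopic a a)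

namespace PosetPi1

/-- The homotopy class of a closed path. -/
def mk {a : K} (p : PosetPath a a) : PosetPi1 a := Quotient.mk _ p

/-- The product is induced by concatenation, `[p] * [q] = [p * q]`. -/
instance (a : K) : Group (PosetPi1 a) where
  mul := Quotient.map₂ PosetPath.comp (fun _ _ hp _ _ hq => PosetPath.homotopic_comp hp hq)
  one := mk (.single (OneSimplex.degen a))
  inv := Quotient.lift (fun p => mk p.rev) (by
    intro p q h
    have hpq : PosetPath.homotopic a a (q.rev.comp p) (.single (OneSimplex.degen a)) :=
      (PosetPath.homotopic a a).trans
        (PosetPath.homotopic_comp ((PosetPath.homotopic a a).refl _) h) (PosetPath.rev_comp q)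
    have hr : ∀ r : PosetPath a a, PosetPath.homotopic a a
        (r.comp (p.comp p.rev)) (r.comp (.single (OneSimplex.degen a))) := by
      intro r
      refine PosetPath.homotopic_comp ((PosetPath.homotopic a a).refl _) ?_
      -- right inverses from left inverses
      have h1 := PosetPath.rev_comp p.rev
      have h2 := PosetPath.rev_comp p
      have s1 : PosetPath.homotopic a a (p.comp p.rev)
          ((p.rev.rev.comp p.rev).comp (p.comp p.rev)) :=
        (PosetPath.homotopic a a).trans
          ((PosetPath.homotopic a a).symm (.rel _ _ (PosetPath.degen_comp (p.comp p.rev))))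
          (PosetPath.homotopic_comp ((PosetPath.homotopic a a).symm h1)
            ((PosetPath.homotopic a a).refl _))
      have s2 : PosetPath.homotopic a a ((p.rev.rev.comp p.rev).comp (p.comp p.rev))
          (p.rev.rev.comp p.rev) := by
        rw [PosetPath.comp_assoc, ← PosetPath.comp_assoc p.rev p p.rev]
        exact PosetPath.homotopic_comp ((PosetPath.homotopic a a).refl _)
          ((PosetPath.homotopic a a).trans
            (PosetPath.homotopic_comp h2 ((PosetPath.homotopic a a).refl _))
            (.rel _ _ (PosetPath.degen_comp p.rev)))
      exact (PosetPath.homotopic a a).trans s1 ((PosetPath.homotopic a a).trans s2 h1)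
    refine Quotient.sound ?_
    have t1 : PosetPath.homotopic a a ((q.rev.comp p).comp p.rev) p.rev :=
      (PosetPath.homotopic a a).trans
        (PosetPath.homotopic_comp hpq ((PosetPath.homotopic a a).refl _))
        (.rel _ _ (PosetPath.degen_comp p.rev))
    have t2 : PosetPath.homotopic a a ((q.rev.comp p).comp p.rev) q.rev := by
      rw [PosetPath.comp_assoc]
      exact (PosetPath.homotopic a a).trans (hr q.rev) (.rel _ _ (PosetPath.comp_degen q.rev))
    exact (PosetPath.homotopic a a).trans ((PosetPath.homotopic a a).symm t1) t2)
  mul_assoc := by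
    rintro ⟨p⟩ ⟨q⟩ ⟨r⟩
    exact congrArg mk (PosetPath.comp_assoc p q r)
  one_mul := by
    rintro ⟨p⟩
    exact Quotient.sound (.rel _ _ (PosetPath.degen_comp p))
  mul_one := by
    rintro ⟨p⟩
    exact Quotient.sound (.rel _ _ (PosetPath.comp_degen p))
  inv_mul_cancel := by
    rintro ⟨p⟩
    exact Quotient.sound (PosetPath.rev_comp p)

end PosetPi1

end PosetHomotopy

/-! ### The first net cohomology with coefficients in a group -/

section Cohomology

/-- A 1-cocycle of `K` with values in the (possibly non-abelian) group `G`. -/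
structure NetCocycle (K : Type u) [PartialOrder K] (G : Type t) [Group G] : Type (max u t) where
  val : ∀ {a b : K}, OneSimplex a b → G
  cocycle : ∀ {x y z : K} (c : TwoSimplex x y z), val c.d0 * val c.d2 = val c.d1

/-- Two 1-cocycles are cohomologous if they are intertwined by a `G`-valued function on
0-simplices. -/
def NetCocycle.cohomologous (K : Type u) [PartialOrder K] (G : Type t) [Group G] :
    Setoid (NetCocycle K G) where
  r z z' := ∃ f : K → G, ∀ {a b : K} (s : OneSimplex a b), f b * z.val s = z'.val s * f a
  iseqv :=
    { refl := fun _ => ⟨fun _ => 1, fun _ => by simp⟩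
      symm := by
        rintro z z' ⟨f, hf⟩
        refine ⟨fun a => (f a)⁻¹, fun {a b} s => ?_⟩
        rw [inv_mul_eq_iff_eq_mul, ← mul_assoc, eq_mul_inv_iff_mul_eq, hf s]
      trans := by
        rintro z z' z'' ⟨f, hf⟩ ⟨g, hg⟩
        refine ⟨fun a => g a * f a, fun {a b} s => ?_⟩
        rw [mul_assoc, hf s, ← mul_assoc, hg s, mul_assoc] }

/-- The first net cohomology `H¹(K, G)`. -/
def NetH1 (K : Type u) [PartialOrder K] (G : Type t) [Group G] : Type (max u t) :=
  Quotient (NetCocycle.cohomologous K G)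

/-- The cohomology class of a 1-cocycle. -/
def NetH1.mk {K : Type u} [PartialOrder K] {G : Type t} [Group G] (z : NetCocycle K G) :
    NetH1 K G := Quotient.mk _ z

namespace NetCocycle

variable {K : Type u} [PartialOrder K] {G : Type t} [Group G]

/-- The value `z(bₙ) ⋯ z(b₁)` of a 1-cocycle on a path `bₙ * ⋯ * b₁`. -/
def onPath (z : NetCocycle K G) {a b : K} (p : PosetPath a b) : G :=
  match p with
  | .single s => z.val s
  | .snoc p s => z.val s * z.onPath p

theorem onPath_comp (z : NetCocycle K G) {a b c : K} (p : PosetPath b c) (q : PosetPath a b) :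
    z.onPath (p.comp q) = z.onPath p * z.onPath q := by
  induction p with
  | single s => rfl
  | snoc p s ih => simp only [PosetPath.comp, onPath, ih, mul_assoc]

theorem onPath_contracts (z : NetCocycle K G) {a b : K} {p q : PosetPath a b}
    (h : PosetPath.Contracts p q) : z.onPath p = z.onPath q := by
  induction h with
  | first c => exact z.cocycle c
  | last r c => simp only [onPath, ← mul_assoc, z.cocycle c]
  | snoc h s ih => simp only [onPath, ih]

theorem onPath_homotopic (z : NetCocycle K G) {a b : K} {p q : PosetPath a b}
    (h : PosetPath.homotopic a b p q) : z.onPath p = z.onPath q := by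
  induction h with
  | rel x y h => exact z.onPath_contracts h
  | refl x => rfl
  | symm x y _ ih => exact ih.symm
  | trans x y z _ _ ih1 ih2 => exact ih1.trans ih2

/-- The morphism `π₁(K, a) → G`, `[p] ↦ z(p)`, defined by a 1-cocycle. -/
def holonomy (z : NetCocycle K G) (a : K) : PosetPi1 a →* G :=
  MonoidHom.mk' (Quotient.lift (fun p => z.onPath p) (fun _ _ h => z.onPath_homotopic h)) (by
    rintro ⟨p⟩ ⟨q⟩
    exact z.onPath_comp p q)

end NetCocycle

/-- Morphisms `Γ → G` are equivalent if they differ by an inner automorphism of `G`. -/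
def homConj (Γ : Type w) [Group Γ] (G : Type t) [Group G] : Setoid (Γ →* G) where
  r φ ψ := ∃ g : G, ∀ γ, ψ γ = g * φ γ * g⁻¹
  iseqv :=
    { refl := fun _ => ⟨1, fun _ => by simp⟩
      symm := by
        rintro φ ψ ⟨g, h⟩
        exact ⟨g⁻¹, fun γ => by rw [h]; group⟩
      trans := by
        rintro φ ψ χ ⟨g, h⟩ ⟨k, h'⟩
        exact ⟨k * g, fun γ => by rw [h', h]; group⟩ }

/-- The set of morphisms `Γ → G` up to inner automorphisms of `G`. -/
def HomDot (Γ : Type w) [Group Γ] (G : Type t) [Group G] : Type (max w t) :=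
  Quotient (homConj Γ G)

/-- The class of a morphism. -/
def HomDot.mk {Γ : Type w} [Group Γ] {G : Type t} [Group G] (φ : Γ →* G) : HomDot Γ G :=
  Quotient.mk _ φ

end Cohomology

/-! ### Net bundles of topological spaces -/

/-- A net bundle of topological spaces over the poset `K`, given by its fibres and by the
homeomorphisms `J_{(b,a)} : X_a → X_b`, `a ≤ b`. The total space is the disjoint union of
the fibres. -/
structure TopNetBundle (K : Type u) [PartialOrder K] : Type (max u (v + 1)) where
  fibre : K → Type v
  top : ∀ a, TopologicalSpace (fibre a)
  J : ∀ {a b : K}, a ≤ b → fibre a ≃ₜ fibre b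
  J_refl : ∀ (a : K) (x : fibre a), J (le_refl a) x = x
  J_trans : ∀ {a b c : K} (hab : a ≤ b) (hbc : b ≤ c) (x : fibre a),
    J hbc (J hab x) = J (hab.trans hbc) x

namespace TopNetBundle

variable {K : Type u} [PartialOrder K]

instance (N : TopNetBundle.{u, v} K) (a : K) : TopologicalSpace (N.fibre a) := N.top a

/-- The dual net bundle over the dual poset, with the same fibres and net structure `J⁻¹`. -/
def dual (N : TopNetBundle.{u, v} K) : TopNetBundle.{u, v} Kᵒᵈ where
  fibre a := N.fibre (OrderDual.ofDual a)
  top a := N.top (OrderDual.ofDual a)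
  J h := (N.J (OrderDual.ofDual_le_ofDual.mpr h)).symm
  J_refl a x := by
    rw [Homeomorph.symm_apply_eq]
    exact (N.J_refl _ x).symm
  J_trans hab hbc x := by
    rw [Homeomorph.symm_apply_eq, Homeomorph.symm_apply_eq, N.J_trans]
    simp

/-- The fibres of `N`, as a family over the space `τK`: the poset `K` with the Alexandroff
topology, whose open sets are the upper sets. -/
def tauFibre (N : TopNetBundle.{u, v} K) (a : WithUpperSet K) : Type v :=
  N.fibre (WithUpperSet.ofUpperSet a)

instance (N : TopNetBundle.{u, v} K) (a : WithUpperSet K) : TopologicalSpace (N.tauFibre a) :=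
  N.top (WithUpperSet.ofUpperSet a)

/-- The cylinder `T_{a,U} = ⋃_{o ≥ a} J_{(o,a)}(U)` in the total space. (The parameter `M` of
`TotalSpace M N.tauFibre` is only a label: this type is the disjoint union of the fibres.) -/
def cylinder (N : TopNetBundle.{u, v} K) (M : Type w) (a : K) (U : Set (N.fibre a)) :
    Set (TotalSpace M N.tauFibre) :=
  {x | ∃ h : a ≤ WithUpperSet.ofUpperSet x.proj, x.snd ∈ N.J h '' U}

/-- The topology of `τX`, generated by the cylinders over the open subsets of the fibres. -/
instance tauTopology (N : TopNetBundle.{u, v} K) (M : Type w) :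
    TopologicalSpace (TotalSpace M N.tauFibre) :=
  TopologicalSpace.generateFrom {T | ∃ (a : K) (U : Set (N.fibre a)),
    IsOpen U ∧ T = N.cylinder M a U}

/-- A choice, for each `a`, of a base of arcwise and simply connected open subsets of the fibre
`X_a`, such that each `J_{(b,a)}` maps the base of `X_a` bijectively onto that of `X_b`. -/
structure FibreBases (N : TopNetBundle.{u, v} K) : Type (max u v) where
  sets : ∀ a, Set (Set (N.fibre a))
  isBasis : ∀ a, TopologicalSpace.IsTopologicalBasis (sets a)
  simplyConnected : ∀ a, ∀ U ∈ sets a, IsSimplyConnected U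
  image_mem_iff : ∀ {a b : K} (h : a ≤ b) (U : Set (N.fibre a)), N.J h '' U ∈ sets b ↔ U ∈ sets a

/-- The same bases, for the dual net bundle. -/
def FibreBases.dual {N : TopNetBundle.{u, v} K} (P : N.FibreBases) : N.dual.FibreBases where
  sets a := P.sets (OrderDual.ofDual a)
  isBasis a := P.isBasis (OrderDual.ofDual a)
  simplyConnected a := P.simplyConnected (OrderDual.ofDual a)
  image_mem_iff {a b} h U := by
    have h' : OrderDual.ofDual b ≤ OrderDual.ofDual a := OrderDual.ofDual_le_ofDual.mpr h
    have key : ∀ V : Set (N.fibre (OrderDual.ofDual a)), N.J h' '' ((N.J h').symm '' V) = V :=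
      fun V => by rw [← image_comp]; simp
    have hV : ∀ V : Set (N.fibre (OrderDual.ofDual a)),
        (N.J h').symm '' V ∈ P.sets (OrderDual.ofDual b) ↔ V ∈ P.sets (OrderDual.ofDual a) :=
      fun V => by rw [← P.image_mem_iff h' ((N.J h').symm '' V), key V]
    exact hV U

/-- The underlying set of the associated poset net bundle: the disjoint union of the chosen
bases of the fibres. -/
@[ext]
structure AssocPoset {N : TopNetBundle.{u, v} K} (P : N.FibreBases) : Type (max u v) where
  base : K
  set : Set (N.fibre base)
  mem : set ∈ P.sets base

/-- The order `≺`: `(a₁, U₁) ≺ (a₀, U₀)` iff `a₁ ≤ a₀` and `J_{(a₀,a₁)}(U₁) ⊆ U₀`. -/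
instance {N : TopNetBundle.{u, v} K} (P : N.FibreBases) : PartialOrder (AssocPoset P) where
  le U₁ U₀ := ∃ h : U₁.base ≤ U₀.base, N.J h '' U₁.set ⊆ U₀.set
  le_refl U := ⟨le_rfl, by
    rintro _ ⟨x, hx, rfl⟩
    rwa [N.J_refl]⟩
  le_trans U₁ U₂ U₃ := by
    rintro ⟨h, hs⟩ ⟨h', hs'⟩
    refine ⟨h.trans h', ?_⟩
    rintro _ ⟨x, hx, rfl⟩
    rw [← N.J_trans h h']
    exact hs' ⟨_, hs ⟨x, hx, rfl⟩, rfl⟩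
  le_antisymm := by
    rintro ⟨a, U, hU⟩ ⟨b, V, hV⟩ ⟨h, hs⟩ ⟨h', hs'⟩
    obtain rfl : a = b := le_antisymm h h'
    obtain rfl : U = V := by
      apply Subset.antisymm
      · intro x hx
        simpa [N.J_refl] using hs ⟨x, hx, rfl⟩
      · intro x hx
        simpa [N.J_refl] using hs' ⟨x, hx, rfl⟩
    rfl

end TopNetBundle

/-! The cylinders over the given bases of the fibres form a base of `τX`. Open sets of `τX` are
stable under the net structure, so a cylinder can be deformed onto its bottom by a jump; hence these
cylinders are simply connected. Their inclusion order is exactly `≺` on the associated poset of the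
dual net bundle. The isomorphism thus reduces to a statement about a path-connected space `Y` with a
base of simply connected open sets: the homotopy group of the base, as a poset, is that of `Y`.

The map `realize` sends a 1-simplex to the unique class of paths inside its support. It is onto by
subdivision of paths (`exists_realize_eq`). For injectivity no homotopy is subdivided: a cocycle `z`
with values in a discrete group defines a covering of `Y` whose monodromy along `realize p` is
`z(p)` (`monodromy_realize`), so `z(p)` depends only on `realize p`. Applied to the tautological
cocycle, with values in the homotopy group of the poset itself, this recovers the class of `p`.

The description of `H¹` is then formal: on a connected poset a cocycle is determined, up to
cohomology, by its holonomy up to conjugation (`cohomologous_iff`, `exists_holonomy`). The bundle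
statement holds because `V_a` is the smallest neighbourhood of `a`, and `J⁻¹` retracts everything
above it onto `X_a`. -/

/-! ### Cocycles on a poset and their holonomy. -/

section PosetCohomology

variable {K : Type u} [PartialOrder K]

namespace PosetPath

theorem comp_rev {a b : K} (p : PosetPath a b) :
    homotopic b b (p.comp p.rev) (single (OneSimplex.degen b)) := by
  induction p with
  | single s =>
    exact .rel _ _ (Contracts.first
      ⟨s, OneSimplex.degen _, s.rev, s.supp, le_rfl, s.end_le, le_rfl⟩)
  | @snoc b c p s ih =>
    have h1 : homotopic c c ((single s).comp ((p.comp p.rev).comp (single s.rev)))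
        ((single s).comp ((single (OneSimplex.degen b)).comp (single s.rev))) :=
      homotopic_comp ((homotopic _ _).refl _) (homotopic_comp ih ((homotopic _ _).refl _))
    have h2 : homotopic c c
        ((single s).comp ((single (OneSimplex.degen b)).comp (single s.rev)))
        ((single s).comp (single s.rev)) :=
      .rel _ _ ((degen_comp _).comp_left _)
    have h3 : homotopic c c ((single s).comp (single s.rev)) (single (OneSimplex.degen c)) :=
      .rel _ _ (Contracts.first ⟨s, OneSimplex.degen _, s.rev, s.supp, le_rfl, s.end_le, le_rfl⟩)
    have h4 : (p.snoc s).comp (p.snoc s).rev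
        = (single s).comp ((p.comp p.rev).comp (single s.rev)) := by
      rw [comp_assoc p]; rfl
    rw [h4]
    exact (homotopic _ _).trans h1 ((homotopic _ _).trans h2 h3)

/-- Inserting a backtrack in the middle of a path does not change its homotopy class. -/
theorem comp_rev_cancel {a b c d : K} (p : PosetPath b c) (r : PosetPath d b) (q : PosetPath a b) :
    homotopic a c ((p.comp r).comp (r.rev.comp q)) (p.comp q) := by
  have h : (p.comp r).comp (r.rev.comp q) = p.comp ((r.comp r.rev).comp q) := by
    simp only [comp_assoc]
  rw [h]
  exact homotopic_comp ((homotopic _ _).refl _) ((homotopic _ _).trans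
    (homotopic_comp (comp_rev r) ((homotopic _ _).refl _)) (.rel _ _ (degen_comp q)))

end PosetPath

namespace NetCocycle

variable {G : Type t} [Group G]

theorem val_degen (z : NetCocycle K G) (a : K) : z.val (OneSimplex.degen a) = 1 := by
  have h := z.cocycle (⟨OneSimplex.degen a, OneSimplex.degen a, OneSimplex.degen a, a,
    le_rfl, le_rfl, le_rfl⟩ : TwoSimplex a a a)
  simpa using h

theorem onPath_rev (z : NetCocycle K G) {a b : K} (p : PosetPath a b) :
    z.onPath p.rev = (z.onPath p)⁻¹ := by
  rw [eq_inv_iff_mul_eq_one, ← z.onPath_comp, z.onPath_homotopic (PosetPath.rev_comp p)]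
  exact z.val_degen a

/-- The image of a cocycle under a morphism of the coefficient groups. -/
def map {H : Type*} [Group H] (χ : G →* H) (z : NetCocycle K G) : NetCocycle K H where
  val s := χ (z.val s)
  cocycle c := by rw [← map_mul, z.cocycle]

theorem onPath_map {H : Type*} [Group H] (χ : G →* H) (z : NetCocycle K G) {a b : K}
    (p : PosetPath a b) : (z.map χ).onPath p = χ (z.onPath p) := by
  induction p with
  | single s => rfl
  | snoc p s ih => simp only [onPath, ih, map_mul]; rfl

/-- The tautological cocycle with values in the homotopy group, defined by a choice of a path
from the base point to each element. -/
def tautological {a : K} (r : ∀ b, PosetPath a b) : NetCocycle K (PosetPi1 a) where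
  val {x y} s := PosetPi1.mk ((r y).rev.comp ((PosetPath.single s).comp (r x)))
  cocycle {x y z} c := by
    refine Quotient.sound ?_
    -- The intermediate path is the product of the two values with the backtrack along `r y`
    -- removed; it contains the pair `∂₀c * ∂₂c`.
    refine (PosetPath.homotopic a a).trans (b :=
      ((r z).rev.comp (.single c.d0)).comp ((PosetPath.single c.d2).comp (r x))) ?_ ?_
    · have h := PosetPath.comp_rev_cancel ((r z).rev.comp (.single c.d0)) (r y)
        ((PosetPath.single c.d2).comp (r x))
      rwa [PosetPath.comp_assoc _ _ (r y)] at h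
    · have h : ((r z).rev.comp (.single c.d0)).comp ((PosetPath.single c.d2).comp (r x))
          = (r z).rev.comp ((((PosetPath.single c.d2).snoc c.d0)).comp (r x)) := by
        simp only [PosetPath.comp_assoc]; rfl
      rw [h]
      exact .rel _ _ (((PosetPath.Contracts.first c).comp_right _).comp_left _)

theorem onPath_tautological {a : K} (r : ∀ b, PosetPath a b) {x y : K} (p : PosetPath x y) :
    (tautological r).onPath p = PosetPi1.mk ((r y).rev.comp (p.comp (r x))) := by
  induction p with
  | single s => rfl
  | @snoc y z p s ih =>
    rw [onPath, ih]
    refine Quotient.sound ?_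
    have h := PosetPath.comp_rev_cancel ((r z).rev.comp (.single s)) (r y) (p.comp (r x))
    rwa [PosetPath.comp_assoc _ _ (r y), PosetPath.comp_assoc _ _ (p.comp (r x))] at h

/-- On closed paths the cocycle returns the class of the path up to conjugation by `r a`, which need
not be trivial. In particular it separates homotopy classes. -/
theorem onPath_tautological_self {a : K} (r : ∀ b, PosetPath a b) (p : PosetPath a a) :
    (tautological r).onPath p
      = (PosetPi1.mk (r a))⁻¹ * (PosetPi1.mk p * PosetPi1.mk (r a)) :=
  onPath_tautological r p

end NetCocycle

variable {G : Type t} [Group G]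

/-- Cohomologous cocycles have conjugate holonomies, and conversely. -/
theorem NetCocycle.cohomologous_iff (hK : PosetPathConnected K) (z z' : NetCocycle K G) (a : K) :
    NetCocycle.cohomologous K G z z' ↔ homConj (PosetPi1 a) G (z.holonomy a) (z'.holonomy a) := by
  constructor
  · rintro ⟨f, hf⟩
    have key : ∀ {x y : K} (p : PosetPath x y), f y * z.onPath p = z'.onPath p * f x := by
      intro x y p
      induction p with
      | single s => exact hf s
      | snoc p s ih => rw [onPath, onPath, ← mul_assoc, hf, mul_assoc, ih, mul_assoc]
    refine ⟨f a, ?_⟩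
    rintro ⟨p⟩
    exact eq_mul_inv_of_mul_eq (key p).symm
  · rintro ⟨g, hg⟩
    have r := fun b => (hK a b).some
    -- The intertwiner is forced by the value `g` at the base point: transport it along `r b` by
    -- both cocycles. The required identity is the conjugation relation on the loop formed by `r x`,
    -- `s` and the reverse of `r y`.
    refine ⟨fun b => z'.onPath (r b) * g * (z.onPath (r b))⁻¹, fun {x y} s => ?_⟩
    have h : z'.onPath ((r y).rev.comp ((PosetPath.single s).comp (r x)))
        = g * z.onPath ((r y).rev.comp ((PosetPath.single s).comp (r x))) * g⁻¹ := hg (PosetPi1.mk _)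
    simp only [onPath_comp, onPath_rev] at h
    change _ * z.onPath (.single s) = z'.onPath (.single s) * _
    have h' := congrArg (fun k => z'.onPath (r y) * k * g) h
    simp only [mul_assoc, inv_mul_cancel, mul_inv_cancel_left, mul_one] at h' ⊢
    refine mul_right_cancel (b := z.onPath (r x)) ?_
    simpa [mul_assoc] using h'.symm

/-- Every morphism of the homotopy group is conjugate to the holonomy of a cocycle. -/
theorem NetCocycle.exists_holonomy (hK : PosetPathConnected K) {a : K} (χ : PosetPi1 a →* G) :
    ∃ z : NetCocycle K G, homConj (PosetPi1 a) G (z.holonomy a) χ := by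
  have r := fun b => (hK a b).some
  refine ⟨(tautological r).map χ, χ (PosetPi1.mk (r a)), ?_⟩
  rintro ⟨p⟩
  change χ (PosetPi1.mk p) = _ * ((tautological r).map χ).onPath p * _
  rw [onPath_map, onPath_tautological_self]
  simp [mul_assoc]

/-- The first net cohomology in terms of the homotopy group. -/
theorem NetH1.exists_equiv_homDot (hK : PosetPathConnected K) {a : K} {Γ : Type*} [Group Γ]
    (φ : PosetPi1 a ≃* Γ) (G : Type t) [Group G] :
    ∃ e : NetH1 K G ≃ HomDot Γ G, ∀ z : NetCocycle K G,
      e (NetH1.mk z) = HomDot.mk ((z.holonomy a).comp φ.symm.toMonoidHom) := by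
  have key : ∀ α β : PosetPi1 a →* G, homConj Γ G (α.comp φ.symm.toMonoidHom)
      (β.comp φ.symm.toMonoidHom) ↔ homConj (PosetPi1 a) G α β := by
    intro α β
    constructor
    · rintro ⟨g, hg⟩
      exact ⟨g, fun γ => by simpa using hg (φ γ)⟩
    · rintro ⟨g, hg⟩
      exact ⟨g, fun γ => hg _⟩
  let F : NetH1 K G → HomDot Γ G := Quotient.lift
    (fun z : NetCocycle K G => HomDot.mk ((z.holonomy a).comp φ.symm.toMonoidHom))
    fun z z' h => Quotient.sound ((key _ _).2 ((NetCocycle.cohomologous_iff hK z z' a).1 h))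
  have hF : Function.Bijective F := by
    constructor
    · rintro ⟨z⟩ ⟨z'⟩ h
      exact Quotient.sound
        ((NetCocycle.cohomologous_iff hK z z' a).2 ((key _ _).1 (Quotient.exact h)))
    · rintro ⟨χ⟩
      obtain ⟨z, hz⟩ := NetCocycle.exists_holonomy hK (χ.comp φ.toMonoidHom)
      refine ⟨NetH1.mk z, Quotient.sound ?_⟩
      have h := (key _ _).2 hz
      have e : (χ.comp φ.toMonoidHom).comp φ.symm.toMonoidHom = χ := by ext; simp
      rwa [e] at h
  exact ⟨Equiv.ofBijective F hF, fun z => rfl⟩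

end PosetCohomology

/-! ### Subdivision of paths along an open cover. -/

section PathSubdivision

open unitInterval

/-- A property of homotopy classes of paths that is stable under concatenation holds for all
classes as soon as it holds for the paths inside the members of an open cover. -/
theorem Path.Homotopic.Quotient.induction_of_openCover {Y : Type*} [TopologicalSpace Y]
    {ι : Type*} {O : ι → Set Y} (hO : ∀ i, IsOpen (O i)) (hc : ∀ y, ∃ i, y ∈ O i)
    {P : ∀ {x y : Y}, Path.Homotopic.Quotient x y → Prop}
    (hlocal : ∀ (i : ι) {x y : Y} (γ : Path x y), (∀ s, γ s ∈ O i) → P (.mk γ))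
    (htrans : ∀ {x y z : Y} (γ : Path.Homotopic.Quotient x y) (δ : Path.Homotopic.Quotient y z),
      P γ → P δ → P (γ.trans δ)) {x y : Y} (γ : Path.Homotopic.Quotient x y) : P γ := by
  induction γ using Path.Homotopic.Quotient.ind with | mk γ =>
  obtain ⟨τ, h0, hmono, ⟨n, hn⟩, hτ⟩ := exists_monotone_Icc_subset_open_cover_unitInterval
    (c := fun i => γ ⁻¹' O i) (fun i => (hO i).preimage γ.continuous)
    (fun s _ => mem_iUnion.2 (hc (γ s)))
  have step : ∀ k, P (.mk (γ.subpath (τ k) (τ (k + 1)))) := by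
    intro k
    obtain ⟨i, hi⟩ := hτ k
    refine hlocal i _ fun s => ?_
    have hs : γ.subpath (τ k) (τ (k + 1)) s ∈ range (γ.subpath (τ k) (τ (k + 1))) := ⟨s, rfl⟩
    rw [γ.range_subpath_of_le _ _ (hmono k.le_succ)] at hs
    obtain ⟨r, hr, hrs⟩ := hs
    rw [← hrs]
    exact hi hr
  have all : ∀ k, P (.mk (γ.subpath (τ 0) (τ k))) := by
    intro k
    induction k with
    | zero =>
      -- The empty initial piece is a constant path, which lies in any member of the cover around
      -- its value.
      rw [Path.subpath_self]
      obtain ⟨i, hi⟩ := hc (γ (τ 0))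
      exact hlocal i _ fun _ => hi
    | succ k ih =>
      have h := htrans _ _ ih (step k)
      rwa [← Path.Homotopic.Quotient.mk_trans,
        Path.Homotopic.Quotient.eq.2 ⟨Path.Homotopy.subpathTransSubpath γ _ _ _⟩] at h
  have h1 := all n
  rw [h0, hn n le_rfl, Path.subpath_zero_one] at h1
  -- The full subpath runs from `γ 0` to `γ 1`, which equal `x` and `y` only propositionally.
  have cast_iff : ∀ {x' y' : Y} (hx : x' = x) (hy : y' = y), P (.mk (γ.cast hx hy)) → P (.mk γ) := by
    rintro x' y' rfl rfl h
    exact h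
  exact cast_iff _ _ h1

end PathSubdivision

/-! ### Realization of poset paths in a space with a simply connected base. -/

/-- A base of a topological space consisting of simply connected open sets, indexed by a poset
whose order corresponds to the inclusion. -/
structure SimplyConnectedBase (Q : Type u) [PartialOrder Q] (Y : Type v) [TopologicalSpace Y] where
  sets : Q → Set Y
  isOpen : ∀ U, IsOpen (sets U)
  simplyConnected : ∀ U, IsSimplyConnected (sets U)
  subset_iff : ∀ {U V}, sets U ⊆ sets V ↔ U ≤ V
  exists_mem_subset : ∀ {y : Y} {S : Set Y}, IsOpen S → y ∈ S → ∃ U, y ∈ sets U ∧ sets U ⊆ S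

namespace SimplyConnectedBase

open Path

variable {Q : Type u} [PartialOrder Q] {Y : Type v} [TopologicalSpace Y]
  (B : SimplyConnectedBase Q Y)

theorem exists_mem (y : Y) : ∃ U, y ∈ B.sets U :=
  let ⟨U, hU, _⟩ := B.exists_mem_subset isOpen_univ (mem_univ y)
  ⟨U, hU⟩

theorem exists_le_le {U V : Q} {y : Y} (hU : y ∈ B.sets U) (hV : y ∈ B.sets V) :
    ∃ W, W ≤ U ∧ W ≤ V ∧ y ∈ B.sets W := by
  obtain ⟨W, hy, hW⟩ := B.exists_mem_subset ((B.isOpen U).inter (B.isOpen V)) ⟨hU, hV⟩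
  exact ⟨W, B.subset_iff.1 (hW.trans inter_subset_left),
    B.subset_iff.1 (hW.trans inter_subset_right), hy⟩

theorem mem_of_le {U V : Q} (h : U ≤ V) {y : Y} (hy : y ∈ B.sets U) : y ∈ B.sets V :=
  B.subset_iff.2 h hy

theorem exists_path (U : Q) {x y : Y} (hx : x ∈ B.sets U) (hy : y ∈ B.sets U) :
    ∃ γ : Path x y, ∀ s, γ s ∈ B.sets U :=
  let h := (B.simplyConnected U).isPathConnected.joinedIn x hx y hy
  ⟨h.somePath, h.somePath_mem⟩

/-- Both paths factor through a simply connected subspace, and the homotopy there is pushed forward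
to `Y`. This frees `cls` from the choice of path. -/
theorem mk_eq_mk (U : Q) {x y : Y} (γ δ : Path x y) (hγ : ∀ s, γ s ∈ B.sets U)
    (hδ : ∀ s, δ s ∈ B.sets U) : Homotopic.Quotient.mk γ = Homotopic.Quotient.mk δ := by
  have := (B.simplyConnected U).simplyConnectedSpace
  have hx : x ∈ B.sets U := by simpa using hγ 0
  have hy : y ∈ B.sets U := by simpa using hγ 1
  let γ' : Path (⟨x, hx⟩ : B.sets U) ⟨y, hy⟩ :=
    { toFun := fun s => ⟨γ s, hγ s⟩, source' := by simp, target' := by simp }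
  let δ' : Path (⟨x, hx⟩ : B.sets U) ⟨y, hy⟩ :=
    { toFun := fun s => ⟨δ s, hδ s⟩, source' := by simp, target' := by simp }
  exact Homotopic.Quotient.eq.2 ((SimplyConnectedSpace.paths_homotopic γ' δ').map
    ⟨Subtype.val, continuous_subtype_val⟩)

/-- The homotopy class of the paths from `x` to `y` inside a member of the base. -/
noncomputable def cls (U : Q) {x y : Y} (hx : x ∈ B.sets U) (hy : y ∈ B.sets U) :
    Homotopic.Quotient x y :=
  .mk (B.exists_path U hx hy).choose

theorem mk_eq_cls (U : Q) {x y : Y} (hx : x ∈ B.sets U) (hy : y ∈ B.sets U) (γ : Path x y)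
    (hγ : ∀ s, γ s ∈ B.sets U) : .mk γ = B.cls U hx hy :=
  B.mk_eq_mk U _ _ hγ (B.exists_path U hx hy).choose_spec

theorem cls_of_le {U V : Q} (h : U ≤ V) {x y : Y} (hx : x ∈ B.sets U) (hy : y ∈ B.sets U) :
    B.cls U hx hy = B.cls V (B.mem_of_le h hx) (B.mem_of_le h hy) :=
  B.mk_eq_cls V _ _ _ fun s => B.mem_of_le h ((B.exists_path U hx hy).choose_spec s)

theorem cls_self (U : Q) {x : Y} (hx : x ∈ B.sets U) : B.cls U hx hx = .refl x :=
  (B.mk_eq_cls U hx hx (.refl x) fun _ => hx).symm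

theorem cls_trans_cls (U : Q) {x y z : Y} (hx : x ∈ B.sets U) (hy : y ∈ B.sets U)
    (hz : z ∈ B.sets U) : (B.cls U hx hy).trans (B.cls U hy hz) = B.cls U hx hz := by
  obtain ⟨γ, hγ⟩ := B.exists_path U hx hy
  obtain ⟨δ, hδ⟩ := B.exists_path U hy hz
  rw [← B.mk_eq_cls U hx hy γ hγ, ← B.mk_eq_cls U hy hz δ hδ, ← Homotopic.Quotient.mk_trans]
  refine B.mk_eq_cls U hx hz _ fun s => ?_
  have h : γ.trans δ s ∈ range (γ.trans δ) := ⟨s, rfl⟩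
  rw [Path.trans_range] at h
  rcases h with ⟨r, hr⟩ | ⟨r, hr⟩
  · exact hr ▸ hγ r
  · exact hr ▸ hδ r

/-- A chosen point of a member of the base. -/
noncomputable def pt (U : Q) : Y := (B.simplyConnected U).nonempty.some

theorem pt_mem (U : Q) : B.pt U ∈ B.sets U := (B.simplyConnected U).nonempty.some_mem

/-- The homotopy class of paths in the support of a 1-simplex that joins its vertices. -/
noncomputable def realizeSimplex {U V : Q} (s : OneSimplex U V) :
    Homotopic.Quotient (B.pt U) (B.pt V) :=
  B.cls s.supp (B.mem_of_le s.start_le (B.pt_mem U)) (B.mem_of_le s.end_le (B.pt_mem V))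

/-- The homotopy class of paths in `Y` described by a path in the poset. -/
noncomputable def realize {U V : Q} (p : PosetPath U V) :
    Homotopic.Quotient (B.pt U) (B.pt V) :=
  match p with
  | .single s => B.realizeSimplex s
  | .snoc p s => (realize p).trans (B.realizeSimplex s)

theorem realize_comp {U V W : Q} (p : PosetPath V W) (q : PosetPath U V) :
    B.realize (p.comp q) = (B.realize q).trans (B.realize p) := by
  induction p with
  | single s => rfl
  | snoc p s ih => simp only [PosetPath.comp, realize, ih, Homotopic.Quotient.trans_assoc]

/-- All three faces can be realized inside the support of `c`, where the class of paths between two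
points is unique. -/
theorem realizeSimplex_trans {U V W : Q} (c : TwoSimplex U V W) :
    (B.realizeSimplex c.d2).trans (B.realizeSimplex c.d0) = B.realizeSimplex c.d1 := by
  simp only [realizeSimplex, B.cls_of_le c.d0_le, B.cls_of_le c.d1_le, B.cls_of_le c.d2_le,
    cls_trans_cls]

theorem realize_homotopic {U V : Q} {p q : PosetPath U V} (h : PosetPath.homotopic U V p q) :
    B.realize p = B.realize q := by
  induction h with
  | rel p q h =>
    clear * - h
    induction h with
    | first c => exact B.realizeSimplex_trans c
    | last r c => simp only [realize, Homotopic.Quotient.trans_assoc, B.realizeSimplex_trans c]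
    | snoc h s ih => simp only [realize, ih]
  | refl x => rfl
  | symm x y _ ih => exact ih.symm
  | trans x y z _ _ ih1 ih2 => exact ih1.trans ih2

/-- Arbitrary endpoints, corrected by `cls`, are needed for the induction: the subdivision points of
a path are not the chosen points `pt`. -/
theorem exists_realize_eq {x y : Y} (γ : Homotopic.Quotient x y) :
    ∀ (U V : Q) (hx : x ∈ B.sets U) (hy : y ∈ B.sets V), ∃ p : PosetPath U V,
      γ.trans (B.cls V hy (B.pt_mem V)) = (B.cls U hx (B.pt_mem U)).trans (B.realize p) := by
  induction γ using Homotopic.Quotient.induction_of_openCover B.isOpen B.exists_mem with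
  | hlocal O γ hγ =>
    rename_i x y
    intro U V hx hy
    have hx' : x ∈ B.sets O := by simpa using hγ 0
    have hy' : y ∈ B.sets O := by simpa using hγ 1
    obtain ⟨W, hWU, hWO, hxW⟩ := B.exists_le_le hx hx'
    obtain ⟨T, hTV, hTO, hyT⟩ := B.exists_le_le hy hy'
    -- The path is `U → W → T → V` with supports `U`, `O`, `V`. The detour through small `W ∋ x` and
    -- `T ∋ y` is needed since `U` and `O`, or `O` and `V`, may have no common upper bound.
    refine ⟨((PosetPath.single ⟨U, le_rfl, hWU⟩).snoc ⟨O, hWO, hTO⟩).snoc ⟨V, hTV, le_rfl⟩, ?_⟩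
    simp only [realize, realizeSimplex]
    rw [← Homotopic.Quotient.trans_assoc, ← Homotopic.Quotient.trans_assoc, cls_trans_cls,
      ← B.cls_of_le hWU hxW (B.pt_mem W), B.cls_of_le hWO hxW (B.pt_mem W), cls_trans_cls,
      ← B.cls_trans_cls O hx' hy', Homotopic.Quotient.trans_assoc,
      ← B.cls_of_le hTO hyT (B.pt_mem T), B.cls_of_le hTV hyT (B.pt_mem T), cls_trans_cls,
      B.mk_eq_cls O hx' hy' γ hγ]
  | htrans γ δ hγ hδ =>
    rename_i x y z
    intro U V hx hz
    obtain ⟨W, hy⟩ := B.exists_mem y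
    obtain ⟨p, hp⟩ := hγ U W hx hy
    obtain ⟨q, hq⟩ := hδ W V hy hz
    refine ⟨q.comp p, ?_⟩
    rw [realize_comp, ← Homotopic.Quotient.trans_assoc, ← hp,
      Homotopic.Quotient.trans_assoc, Homotopic.Quotient.trans_assoc, hq]

theorem realize_surjective (U V : Q) :
    Function.Surjective (B.realize : PosetPath U V → _) := by
  intro γ
  obtain ⟨p, hp⟩ := B.exists_realize_eq γ U V (B.pt_mem U) (B.pt_mem V)
  rw [cls_self, cls_self, Homotopic.Quotient.trans_refl, Homotopic.Quotient.refl_trans] at hp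
  exact ⟨p, hp.symm⟩

theorem posetPathConnected {Q : Type u} [PartialOrder Q] {Y : Type v} [TopologicalSpace Y]
    (B : SimplyConnectedBase Q Y) [PathConnectedSpace Y] : PosetPathConnected Q := fun U V =>
  let ⟨p, _⟩ := B.realize_surjective U V (.mk (PathConnectedSpace.somePath _ _))
  ⟨p⟩

end SimplyConnectedBase

/-! ### The covering defined by a cocycle, and injectivity of the realization. -/

namespace NetCocycle

variable {K : Type u} [PartialOrder K] {G : Type t} [Group G]

/-- The value of a cocycle on the 1-simplex from `U` to `V`, supported on `V`, for `U ≤ V`. -/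
def ofLE (z : NetCocycle K G) {U V : K} (h : U ≤ V) : G := z.val ⟨V, h, le_rfl⟩

theorem ofLE_mul_ofLE (z : NetCocycle K G) {U V W : K} (hUV : U ≤ V) (hVW : V ≤ W) :
    z.ofLE hVW * z.ofLE hUV = z.ofLE (hUV.trans hVW) :=
  z.cocycle (⟨⟨W, hVW, le_rfl⟩, ⟨W, hUV.trans hVW, le_rfl⟩, ⟨V, hUV, le_rfl⟩, W,
    le_rfl, le_rfl, hVW⟩ : TwoSimplex U V W)

/-- This expresses every value of a cocycle through its values on inclusions, which serve as
transition data. -/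
theorem ofLE_mul_val (z : NetCocycle K G) {U V : K} (s : OneSimplex U V) :
    z.ofLE s.end_le * z.val s = z.ofLE s.start_le :=
  z.cocycle (⟨⟨s.supp, s.end_le, le_rfl⟩, ⟨s.supp, s.start_le, le_rfl⟩, s, s.supp,
    le_rfl, le_rfl, le_rfl⟩ : TwoSimplex U V s.supp)

end NetCocycle

namespace SimplyConnectedBase

open Path

variable {Q : Type u} [PartialOrder Q] {Y : Type v} [TopologicalSpace Y]
  (B : SimplyConnectedBase Q Y) {G : Type t} [Group G] (z : NetCocycle Q G)

/-- A member of the base around a given point. -/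
noncomputable def nbhd (y : Y) : Q := (B.exists_mem y).choose

theorem mem_nbhd (y : Y) : y ∈ B.sets (B.nbhd y) := (B.exists_mem y).choose_spec

open Classical in
/-- The comparison, at the point `y ∈ U`, between the chart `U` and the chart `B.nbhd y` of the
local system defined by a cocycle. -/
noncomputable def chart (U : Q) (y : Y) : G :=
  if h : y ∈ B.sets U then
    let hW := (B.exists_le_le h (B.mem_nbhd y)).choose_spec
    z.ofLE hW.1 * (z.ofLE hW.2.1)⁻¹
  -- The value off `U` is arbitrary: the algebraic identities for `coordChange` hold for any
  -- `chart`, and continuity only involves points of `U`.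
  else 1

/-- Independence of the choice of `W`: two choices are compared on a member `T` around `y` below
both. -/
theorem chart_eq {U W : Q} {y : Y} (hU : W ≤ U) (hn : W ≤ B.nbhd y) (hy : y ∈ B.sets W) :
    B.chart z U y = z.ofLE hU * (z.ofLE hn)⁻¹ := by
  have h : y ∈ B.sets U := B.mem_of_le hU hy
  rw [chart, dif_pos h]
  obtain ⟨h1, h2, h3⟩ := (B.exists_le_le h (B.mem_nbhd y)).choose_spec
  obtain ⟨T, hT, hTW, -⟩ := B.exists_le_le h3 hy
  dsimp only
  rw [← div_eq_mul_inv, ← div_eq_mul_inv, ← mul_div_mul_right_eq_div _ _ (z.ofLE hT),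
    z.ofLE_mul_ofLE, z.ofLE_mul_ofLE, ← mul_div_mul_right_eq_div (z.ofLE hU) _ (z.ofLE hTW),
    z.ofLE_mul_ofLE, z.ofLE_mul_ofLE]

theorem chart_of_le {U V : Q} (h : U ≤ V) {y : Y} (hy : y ∈ B.sets U) :
    B.chart z V y = z.ofLE h * B.chart z U y := by
  obtain ⟨W, hU, hn, hW⟩ := B.exists_le_le hy (B.mem_nbhd y)
  rw [B.chart_eq z hU hn hW, B.chart_eq z (hU.trans h) hn hW, ← mul_assoc, z.ofLE_mul_ofLE]

theorem chart_nbhd (y : Y) : B.chart z (B.nbhd y) y = 1 := by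
  rw [B.chart_eq z le_rfl le_rfl (B.mem_nbhd y), mul_inv_cancel]

/-- The principal covering of `Y` defined by a cocycle of the base. -/
noncomputable def coveringCore [TopologicalSpace G] [DiscreteTopology G] :
    FiberBundleCore Q Y G where
  baseSet := B.sets
  isOpen_baseSet := B.isOpen
  indexAt := B.nbhd
  mem_baseSet_at := B.mem_nbhd
  coordChange U V y g := B.chart z V y * (B.chart z U y)⁻¹ * g
  coordChange_self U y _ g := by simp
  continuousOn_coordChange U V := by
    refine continuousOn_of_forall_continuousAt ?_
    rintro ⟨y, g⟩ ⟨⟨hU, hV⟩, -⟩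
    obtain ⟨W, hWU, hWV, hW⟩ := B.exists_le_le hU hV
    have hn : B.sets W ×ˢ {g} ∈ 𝓝 (y, g) :=
      prod_mem_nhds ((B.isOpen W).mem_nhds hW) (by simp)
    refine (continuousAt_const (y := B.chart z V y * (B.chart z U y)⁻¹ * g)).congr ?_
    filter_upwards [hn]
    rintro ⟨y', g'⟩ ⟨hy', rfl⟩
    -- A single chart need not be locally constant, since `B.nbhd` jumps with the point. In the
    -- quotient of two charts this dependence cancels, as both factor through the chart `W`.
    have key : ∀ x ∈ B.sets W, B.chart z V x * (B.chart z U x)⁻¹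
        = z.ofLE hWV * (z.ofLE hWU)⁻¹ := fun x hx => by
      rw [B.chart_of_le z hWV hx, B.chart_of_le z hWU hx]; group
    simp only [key y hW, key y' hy']
  coordChange_comp U V W y _ g := by group

theorem isCoveringMap [TopologicalSpace G] [DiscreteTopology G] :
    IsCoveringMap (π G (B.coveringCore z).Fiber) :=
  FiberBundle.isCoveringMap

/-- A point of the covering with a given coordinate in the distinguished chart. -/
def lift [TopologicalSpace G] [DiscreteTopology G] (y : Y) (g : G) :
    π G (B.coveringCore z).Fiber ⁻¹' {y} := ⟨⟨y, g⟩, rfl⟩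

/-- The two points of the covering are those with coordinate `k` in the chart `U`. A path inside `U`
is lifted by keeping that coordinate constant. -/
theorem monodromy_cls [TopologicalSpace G] [DiscreteTopology G] (U : Q) {x y : Y}
    (hx : x ∈ B.sets U) (hy : y ∈ B.sets U) (k : G) :
    (B.isCoveringMap z).monodromy (B.cls U hx hy) (B.lift z x ((B.chart z U x)⁻¹ * k))
      = B.lift z y ((B.chart z U y)⁻¹ * k) := by
  obtain ⟨γ, hγ⟩ := B.exists_path U hx hy
  rw [← B.mk_eq_cls U hx hy γ hγ]
  have hval : ∀ s, ((B.coveringCore z).localTrivAsPartialEquiv U).symm (γ s, k)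
      = (B.lift z (γ s) ((B.chart z U (γ s))⁻¹ * k)).1 := by
    intro s
    change (⟨γ s, B.chart z (B.nbhd (γ s)) (γ s) * (B.chart z U (γ s))⁻¹ * k⟩ :
      TotalSpace G (B.coveringCore z).Fiber) = _
    rw [chart_nbhd, one_mul]
    rfl
  have hcont : Continuous fun s => ((B.coveringCore z).localTrivAsPartialEquiv U).symm (γ s, k) := by
    refine ((B.coveringCore z).localTriv U).continuousOn_invFun.comp_continuous
      (f := fun s => (γ s, k)) (by fun_prop) fun s => ?_
    exact ⟨hγ s, mem_univ _⟩
  let Γ : Path (B.lift z x ((B.chart z U x)⁻¹ * k)).1 (B.lift z y ((B.chart z U y)⁻¹ * k)).1 :=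
    { toFun := fun s => ((B.coveringCore z).localTrivAsPartialEquiv U).symm (γ s, k)
      continuous_toFun := hcont
      source' := by rw [hval, γ.source]
      target' := by rw [hval, γ.target] }
  refine (B.isCoveringMap z).monodromy_eq_of_map_eq (.mk Γ) ?_
  exact congrArg Homotopic.Quotient.mk (Path.ext rfl)

/-- For one simplex: pass from the chart `U` to that of the support by `ofLE s.start_le`, move there
with constant coordinate, and return to the chart `V` by the inverse of `ofLE s.end_le`. By
`ofLE_mul_val` the total factor is `z.val s`. -/
theorem monodromy_realize [TopologicalSpace G] [DiscreteTopology G] {U V : Q}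
    (p : PosetPath U V) (k : G) :
    (B.isCoveringMap z).monodromy (B.realize p)
        (B.lift z (B.pt U) ((B.chart z U (B.pt U))⁻¹ * k))
      = B.lift z (B.pt V) ((B.chart z V (B.pt V))⁻¹ * (z.onPath p * k)) := by
  have simplex : ∀ {U V : Q} (s : OneSimplex U V) (k : G),
      (B.isCoveringMap z).monodromy (B.realizeSimplex s)
        (B.lift z (B.pt U) ((B.chart z U (B.pt U))⁻¹ * k))
      = B.lift z (B.pt V) ((B.chart z V (B.pt V))⁻¹ * (z.val s * k)) := by
    intro U V s k
    have h := B.monodromy_cls z s.supp (B.mem_of_le s.start_le (B.pt_mem U))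
      (B.mem_of_le s.end_le (B.pt_mem V)) (z.ofLE s.start_le * k)
    rw [B.chart_of_le z s.start_le (B.pt_mem U), B.chart_of_le z s.end_le (B.pt_mem V)] at h
    have h1 : (z.ofLE s.start_le * B.chart z U (B.pt U))⁻¹ * (z.ofLE s.start_le * k)
        = (B.chart z U (B.pt U))⁻¹ * k := by group
    have h2 : (z.ofLE s.end_le * B.chart z V (B.pt V))⁻¹ * (z.ofLE s.start_le * k)
        = (B.chart z V (B.pt V))⁻¹ * (z.val s * k) := by
      rw [← z.ofLE_mul_val s]; group
    rwa [h1, h2] at h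
  induction p with
  | single s => exact simplex s k
  | snoc p s ih =>
    rw [realize, IsCoveringMap.monodromy_trans_apply, ih, simplex, NetCocycle.onPath, mul_assoc]

/-- Monodromy depends only on the homotopy class in `Y`, and it determines the value of the cocycle.
The discrete topology on `G` is introduced only for this purpose. -/
theorem onPath_eq_of_realize_eq {U V : Q} {p q : PosetPath U V} (h : B.realize p = B.realize q) :
    z.onPath p = z.onPath q := by
  let _ : TopologicalSpace G := ⊥
  have _ : DiscreteTopology G := ⟨rfl⟩
  have hp := B.monodromy_realize z p 1
  rw [h, B.monodromy_realize z q 1] at hp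
  have h' : (B.chart z V (B.pt V))⁻¹ * (z.onPath q * 1)
      = (B.chart z V (B.pt V))⁻¹ * (z.onPath p * 1) :=
    congrArg (fun e : π G (B.coveringCore z).Fiber ⁻¹' {B.pt V} => (e.1.2 : G)) hp
  simpa using h'.symm

/-- The realization of closed paths, as a morphism into the fundamental group. -/
noncomputable def realizeHom (U : Q) : PosetPi1 U →* FundamentalGroup Y (B.pt U) :=
  MonoidHom.mk' (Quotient.lift (fun p => B.realize p) fun _ _ h => B.realize_homotopic h) (by
    rintro ⟨p⟩ ⟨q⟩
    -- Both groups multiply from right to left, so the reversal of order in `realize_comp` is the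
    -- right one.
    exact B.realize_comp p q)

theorem realizeHom_surjective (U : Q) : Function.Surjective (B.realizeHom U) := fun γ =>
  let ⟨p, hp⟩ := B.realize_surjective U U γ
  ⟨PosetPi1.mk p, hp⟩

/-- The coefficient group is `PosetPi1 U` itself: the tautological cocycle then recovers the class
of a closed path from its realization. -/
theorem realizeHom_injective [PathConnectedSpace Y] (U : Q) :
    Function.Injective (B.realizeHom U) := by
  have r := fun V => (B.posetPathConnected U V).some
  rintro ⟨p⟩ ⟨q⟩ h
  have h' := B.onPath_eq_of_realize_eq (NetCocycle.tautological r) (p := p) (q := q) h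
  rw [NetCocycle.onPath_tautological_self, NetCocycle.onPath_tautological_self] at h'
  exact mul_right_cancel (mul_left_cancel h')

/-- The homotopy group of a base of simply connected sets is the fundamental group. -/
noncomputable def pi1Equiv [PathConnectedSpace Y] (U : Q) (x : Y) :
    PosetPi1 U ≃* FundamentalGroup Y x :=
  (MulEquiv.ofBijective (B.realizeHom U)
    ⟨B.realizeHom_injective U, B.realizeHom_surjective U⟩).trans
    (FundamentalGroup.fundamentalGroupMulEquivOfPathConnected _ _)

end SimplyConnectedBase

/-! ### The topology of `τX` and its local triviality. -/

namespace TopNetBundle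

variable {K : Type u} [PartialOrder K] (N : TopNetBundle.{u, v} K) (M : Type w)

/-- The inclusion of a fibre into the total space. -/
def incl (a : K) (x : N.fibre a) : TotalSpace M N.tauFibre := ⟨WithUpperSet.toUpperSet a, x⟩

variable {N M}

theorem incl_mem_cylinder {a b : K} {U : Set (N.fibre a)} {x : N.fibre b} :
    N.incl M b x ∈ N.cylinder M a U ↔ ∃ h : a ≤ b, x ∈ N.J h '' U := Iff.rfl

theorem incl_self_mem_cylinder {a : K} {U : Set (N.fibre a)} {x : N.fibre a} :
    N.incl M a x ∈ N.cylinder M a U ↔ x ∈ U := by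
  rw [incl_mem_cylinder]
  constructor
  · rintro ⟨h, y, hy, rfl⟩
    rwa [N.J_refl]
  · exact fun hx => ⟨le_rfl, x, hx, N.J_refl a x⟩

/-- A set is open in `τX` if and only if it is stable under the net structure and its
intersections with the fibres are open. -/
theorem isOpen_iff {S : Set (TotalSpace M N.tauFibre)} :
    IsOpen S ↔ (∀ a, IsOpen (N.incl M a ⁻¹' S)) ∧
      ∀ (a b : K) (h : a ≤ b) (x : N.fibre a), N.incl M a x ∈ S → N.incl M b (N.J h x) ∈ S := by
  constructor
  · intro hS
    induction hS with
    | basic T hT =>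
      obtain ⟨a, U, hU, rfl⟩ := hT
      refine ⟨fun b => ?_, ?_⟩
      · by_cases h : a ≤ b
        · have e : N.incl M b ⁻¹' N.cylinder M a U = N.J h '' U := by
            ext x; exact ⟨fun ⟨_, hx⟩ => hx, fun hx => ⟨h, hx⟩⟩
          rw [e]
          exact (N.J h).isOpenMap _ hU
        · have e : N.incl M b ⁻¹' N.cylinder M a U = ∅ :=
            eq_empty_of_forall_notMem fun x hx => h hx.1
          rw [e]
          exact isOpen_empty
      · rintro b c h x ⟨hab, y, hy, hyx⟩
        exact ⟨hab.trans h, y, hy, (N.J_trans hab h y).symm.trans (congrArg (N.J h) hyx)⟩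
    | univ => exact ⟨fun _ => isOpen_univ, fun _ _ _ _ _ => trivial⟩
    | inter S T _ _ hS hT =>
      exact ⟨fun a => (hS.1 a).inter (hT.1 a), fun a b h x hx =>
        ⟨hS.2 a b h x hx.1, hT.2 a b h x hx.2⟩⟩
    | sUnion F _ hF =>
      refine ⟨fun a => ?_, ?_⟩
      · rw [preimage_sUnion]
        exact isOpen_biUnion fun T hT => (hF T hT).1 a
      · rintro a b h x ⟨T, hT, hx⟩
        exact ⟨T, hT, (hF T hT).2 a b h x hx⟩
  · rintro ⟨hS, hJ⟩
    have e : S = ⋃ a, N.cylinder M a (N.incl M a ⁻¹' S) := by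
      ext y
      rw [mem_iUnion]
      constructor
      · exact fun hy => ⟨_, incl_self_mem_cylinder.2 hy⟩
      · rintro ⟨a, h, x, hx, hxy⟩
        have h' := hJ a _ h x hx
        rwa [hxy] at h'
    rw [e]
    exact isOpen_iUnion fun a => TopologicalSpace.GenerateOpen.basic _ ⟨a, _, hS a, rfl⟩

theorem isOpen_cylinder {a : K} {U : Set (N.fibre a)} (hU : IsOpen U) :
    IsOpen (N.cylinder M a U) :=
  TopologicalSpace.GenerateOpen.basic _ ⟨a, U, hU, rfl⟩

theorem cylinder_subset_of_isOpen {S : Set (TotalSpace M N.tauFibre)} (hS : IsOpen S) {a : K}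
    {U : Set (N.fibre a)} (hU : ∀ x ∈ U, N.incl M a x ∈ S) : N.cylinder M a U ⊆ S := by
  rintro y ⟨h, x, hx, hxy⟩
  have h' := (isOpen_iff.1 hS).2 a _ h x (hU x hx)
  rwa [hxy] at h'

/-- Everything is decided on the bottom of the first cylinder. Inclusion reverses the order of the
base points, which is why the dual net bundle occurs; a point of `U` is needed to compare `a` and
`b`. -/
theorem cylinder_subset_cylinder_iff {a b : K} {U : Set (N.fibre a)} {V : Set (N.fibre b)}
    (hU : U.Nonempty) : N.cylinder M a U ⊆ N.cylinder M b V ↔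
      ∃ h : b ≤ a, (N.J h).symm '' U ⊆ V := by
  constructor
  · intro hs
    have h : ∀ x ∈ U, ∃ h : b ≤ a, x ∈ N.J h '' V := fun x hx =>
      hs (incl_self_mem_cylinder.2 hx)
    obtain ⟨x, hx⟩ := hU
    refine ⟨(h x hx).1, ?_⟩
    rintro _ ⟨y, hy, rfl⟩
    obtain ⟨_, z, hz, rfl⟩ := h y hy
    rwa [Homeomorph.symm_apply_apply]
  · rintro ⟨h, hs⟩ y ⟨hy, x, hx, hxy⟩
    refine ⟨h.trans hy, (N.J h).symm x, hs ⟨x, hx, rfl⟩, ?_⟩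
    rw [← hxy, ← N.J_trans h hy, Homeomorph.apply_symm_apply]

theorem mem_cylinder_iff {a : K} {U : Set (N.fibre a)} {y : TotalSpace M N.tauFibre}
    (h : a ≤ WithUpperSet.ofUpperSet y.proj) :
    y ∈ N.cylinder M a U ↔ (N.J h).symm y.snd ∈ U := by
  constructor
  · rintro ⟨_, x, hx, hxy⟩
    have e : (N.J h).symm y.snd = x := ((N.J h).symm_apply_eq).2 hxy.symm
    rwa [e]
  · exact fun hx => ⟨h, _, hx, (N.J h).apply_symm_apply _⟩

theorem incl_apply_symm {a : K} {y : TotalSpace M N.tauFibre}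
    (h : a ≤ WithUpperSet.ofUpperSet y.proj) :
    N.incl M _ (N.J h ((N.J h).symm y.snd)) = y :=
  congrArg (N.incl M _) ((N.J h).apply_symm_apply _)

open Classical in
/-- The retraction of `p⁻¹(V_a)` onto the fibre `X_a`, extended by a constant. -/
noncomputable def retract (a : K) (x₀ : N.fibre a) (y : TotalSpace M N.tauFibre) : N.fibre a :=
  if h : a ≤ WithUpperSet.ofUpperSet y.proj then (N.J h).symm y.snd else x₀

theorem retract_mem_iff {a : K} {x₀ : N.fibre a} {y : TotalSpace M N.tauFibre}
    (h : a ≤ WithUpperSet.ofUpperSet y.proj) {U : Set (N.fibre a)} :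
    retract a x₀ y ∈ U ↔ y ∈ N.cylinder M a U := by
  rw [retract, dif_pos h, mem_cylinder_iff h]

theorem continuousOn_retract (a : K) (x₀ : N.fibre a) :
    ContinuousOn (retract a x₀ : TotalSpace M N.tauFibre → N.fibre a)
      {y | a ≤ WithUpperSet.ofUpperSet y.proj} := by
  rw [continuousOn_iff']
  refine fun U hU => ⟨N.cylinder M a U, isOpen_cylinder hU, ?_⟩
  ext y
  exact ⟨fun ⟨h1, h2⟩ => ⟨(retract_mem_iff h2).1 h1, h2⟩,
    fun ⟨h1, h2⟩ => ⟨(retract_mem_iff h2).2 h1, h2⟩⟩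

theorem continuous_incl (a : K) : Continuous (N.incl M a) :=
  continuous_def.2 fun _ hS => (isOpen_iff.1 hS).1 a

theorem isInducing_incl (a : K) : IsInducing (N.incl M a) := by
  refine ⟨le_antisymm (continuous_incl a).le_induced fun U hU => ?_⟩
  exact ⟨N.cylinder M a U, isOpen_cylinder hU, Set.ext fun x => incl_self_mem_cylinder⟩

theorem isOpen_setOf_le (a : K) :
    IsOpen {b : WithUpperSet K | a ≤ WithUpperSet.ofUpperSet b} :=
  Topology.IsUpperSet.isOpen_iff_isUpperSet.2 fun _ _ hbc hb => le_trans hb hbc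

theorem continuous_proj : Continuous (π M N.tauFibre) := by
  refine continuous_def.2 fun S hS => isOpen_iff.2 ⟨fun a => ?_, fun a b h x hx => ?_⟩
  · exact isOpen_const (p := WithUpperSet.toUpperSet a ∈ S)
  · exact Topology.IsUpperSet.isOpen_iff_isUpperSet.1 hS h hx

/-- The total space over `V_a` is the product of `V_a` with the standard fibre. -/
noncomputable def localTrivialization [TopologicalSpace M] (a : K) (e : M ≃ₜ N.fibre a) (m : M) :
    Trivialization M (π M N.tauFibre) where
  toFun y := (y.proj, e.symm (retract a (e m) y))
  invFun p := open Classical in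
    if h : a ≤ WithUpperSet.ofUpperSet p.1 then N.incl M _ (N.J h (e p.2)) else N.incl M a (e m)
  source := π M N.tauFibre ⁻¹' {b | a ≤ WithUpperSet.ofUpperSet b}
  target := {b | a ≤ WithUpperSet.ofUpperSet b} ×ˢ univ
  map_source' y hy := ⟨hy, trivial⟩
  map_target' p hp := by
    have h : a ≤ WithUpperSet.ofUpperSet p.1 := hp.1
    simp only [dif_pos h]
    exact h
  left_inv' y hy := by
    have h : a ≤ WithUpperSet.ofUpperSet y.proj := hy
    simp only [dif_pos h, retract, Homeomorph.apply_symm_apply]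
    exact incl_apply_symm h
  right_inv' p hp := by
    have h : a ≤ WithUpperSet.ofUpperSet p.1 := hp.1
    have h' : retract a (e m) (N.incl M _ (N.J h (e p.2))) = e p.2 :=
      (dif_pos h).trans ((N.J h).symm_apply_apply _)
    simp only [dif_pos h, h', Homeomorph.symm_apply_apply]
    rfl
  open_source := (isOpen_setOf_le a).preimage continuous_proj
  open_target := (isOpen_setOf_le a).prod isOpen_univ
  continuousOn_toFun := continuous_proj.continuousOn.prodMk
    (e.symm.continuous.comp_continuousOn (continuousOn_retract a (e m)))
  continuousOn_invFun := by
    rw [continuousOn_open_iff ((isOpen_setOf_le a).prod isOpen_univ)]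
    intro S hS
    rw [isOpen_prod_iff]
    rintro b x ⟨⟨hb, -⟩, hx⟩
    have h : a ≤ WithUpperSet.ofUpperSet b := hb
    have hx' : N.incl M _ (N.J h (e x)) ∈ S := by
      simpa only [mem_preimage, dif_pos h] using hx
    -- The box is `V_b` times the trace of `S` on the fibre over `b`, read in `M`; stability of `S`
    -- under the net structure carries this trace to all fibres over `V_b`.
    refine ⟨{c | WithUpperSet.ofUpperSet b ≤ WithUpperSet.ofUpperSet c},
      {y | N.incl M _ (N.J h (e y)) ∈ S}, isOpen_setOf_le _, ?_, le_rfl, hx', ?_⟩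
    · exact hS.preimage ((continuous_incl _).comp ((N.J h).continuous.comp e.continuous))
    · rintro ⟨c, y⟩ ⟨hc, hy⟩
      have hc' : a ≤ WithUpperSet.ofUpperSet c := h.trans hc
      refine ⟨⟨hc', trivial⟩, ?_⟩
      simp only [mem_preimage, dif_pos hc']
      rw [← N.J_trans h hc]
      exact (isOpen_iff.1 hS).2 _ _ hc _ hy
  baseSet := {b | a ≤ WithUpperSet.ofUpperSet b}
  open_baseSet := isOpen_setOf_le a
  source_eq := rfl
  target_eq := rfl
  proj_toFun _ _ := rfl

theorem nonempty_homeomorph_fibre [TopologicalSpace M] (hK : PosetPathConnected K) {a₀ : K}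
    (e : M ≃ₜ N.fibre a₀) (a : K) : Nonempty (M ≃ₜ N.fibre a) := by
  obtain ⟨p⟩ := hK a₀ a
  induction p with
  | single s => exact ⟨e.trans ((N.J s.start_le).trans (N.J s.end_le).symm)⟩
  | snoc p s ih =>
    obtain ⟨e'⟩ := ih
    exact ⟨e'.trans ((N.J s.start_le).trans (N.J s.end_le).symm)⟩

theorem nonempty_fiberBundle [TopologicalSpace M] [Nonempty M] (e : ∀ a, M ≃ₜ N.fibre a) :
    Nonempty (FiberBundle M N.tauFibre) :=
  ⟨{ totalSpaceMk_isInducing' := fun b => isInducing_incl (WithUpperSet.ofUpperSet b)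
     -- A topological fibre bundle imposes no condition on transition maps, so every local
     -- trivialization is admitted.
     trivializationAtlas' := univ
     trivializationAt' := fun a =>
       localTrivialization (WithUpperSet.ofUpperSet a) (e _) (Classical.arbitrary M)
     mem_baseSet_trivializationAt' := fun a => le_refl (WithUpperSet.ofUpperSet a)
     trivialization_mem_atlas' := fun _ => trivial }⟩

/-! ### Cylinders are homotopy equivalent to their bottoms. -/

section Cylinder

open unitInterval

variable {a : K} {W : Set (N.fibre a)}

/-- The retraction of a cylinder onto its bottom. -/
noncomputable def cylinderRetract (a : K) (W : Set (N.fibre a)) (y : N.cylinder M a W) : W :=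
  ⟨(N.J y.2.1).symm y.1.snd, (mem_cylinder_iff y.2.1).1 y.2⟩

theorem continuous_cylinderRetract : Continuous (cylinderRetract (M := M) a W) := by
  refine Continuous.subtype_mk (continuous_def.2 fun U hU => ?_) _
  refine ⟨N.cylinder M a U, isOpen_cylinder hU, ?_⟩
  ext y
  exact mem_cylinder_iff y.2.1

/-- The inclusion of the bottom of a cylinder. -/
def cylinderIncl (W : Set (N.fibre a)) (x : W) : N.cylinder M a W :=
  ⟨N.incl M a x, incl_self_mem_cylinder.2 x.2⟩

theorem continuous_cylinderIncl : Continuous (cylinderIncl (M := M) W) :=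
  ((continuous_incl a).comp continuous_subtype_val).subtype_mk _

open Classical in
/-- The deformation of a cylinder that jumps from the bottom to the identity. -/
noncomputable def cylinderHomotopy (a : K) (W : Set (N.fibre a)) :
    ContinuousMap.Homotopy
      ((⟨cylinderIncl W, continuous_cylinderIncl⟩ : C(W, N.cylinder M a W)).comp
        ⟨cylinderRetract a W, continuous_cylinderRetract⟩)
      (ContinuousMap.id _) where
  toFun q := if q.1 = 0 then cylinderIncl W (cylinderRetract a W q.2) else q.2
  continuous_toFun := by
    rw [continuous_def]
    rintro _ ⟨S, hS, rfl⟩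
    -- An open set containing the bottom point below `y` contains `y`. Hence the jump at time `0` is
    -- continuous: being in `S` at time `0` forces being in `S` at all later times.
    have key : ∀ y : N.cylinder M a W, (cylinderIncl W (cylinderRetract a W y)).1 ∈ S →
        y.1 ∈ S := fun y hy => by
      have h := (isOpen_iff.1 hS).2 _ _ y.2.1 _ hy
      rwa [← incl_apply_symm y.2.1]
    have e : (fun q : I × N.cylinder M a W =>
        if q.1 = 0 then cylinderIncl W (cylinderRetract a W q.2) else q.2) ⁻¹' (Subtype.val ⁻¹' S)
        = ({0}ᶜ ×ˢ (Subtype.val ⁻¹' S)) ∪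
          univ ×ˢ ((cylinderIncl W ∘ cylinderRetract a W) ⁻¹' (Subtype.val ⁻¹' S)) := by
      ext ⟨s, y⟩
      by_cases hs : s = 0
      · simp [hs]
      · simp only [mem_preimage, mem_union, mem_prod, mem_compl_iff, mem_singleton_iff, hs,
          if_false, not_false_eq_true, true_and, mem_univ, Function.comp_apply]
        exact ⟨Or.inl, fun h => h.elim id (key y)⟩
    rw [e]
    have hS' := hS.preimage (continuous_subtype_val (p := (· ∈ N.cylinder M a W)))
    exact (isOpen_compl_singleton.prod hS').union (isOpen_univ.prod
      (hS'.preimage (continuous_cylinderIncl.comp continuous_cylinderRetract)))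
  map_zero_left y := by simp
  map_one_left y := by simp

theorem isSimplyConnected_cylinder (hW : IsSimplyConnected W) :
    IsSimplyConnected (N.cylinder M a W) := by
  have := hW.simplyConnectedSpace
  let e : ContinuousMap.HomotopyEquiv (N.cylinder M a W) W :=
    { toFun := ⟨cylinderRetract a W, continuous_cylinderRetract⟩
      invFun := ⟨cylinderIncl W, continuous_cylinderIncl⟩
      left_inv := ⟨cylinderHomotopy a W⟩
      right_inv := by
        have h : (⟨cylinderRetract a W, continuous_cylinderRetract⟩ :
            C(N.cylinder M a W, W)).comp ⟨cylinderIncl W, continuous_cylinderIncl⟩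
            = ContinuousMap.id _ := by
          ext x
          exact ((N.J (le_refl a)).symm_apply_eq).2 (N.J_refl a x).symm
        rw [h] }
  exact e.simplyConnectedSpace

end Cylinder

/-! ### The base of cylinders, path-connectedness of `τX`, and the conclusion. -/

/-- The base of `τX` formed by the cylinders over the chosen bases of the fibres. -/
def FibreBases.simplyConnectedBase (P : N.FibreBases) (M : Type w) :
    SimplyConnectedBase (AssocPoset P.dual) (TotalSpace M N.tauFibre) where
  sets U := N.cylinder M (OrderDual.ofDual U.base) U.set
  isOpen U := isOpen_cylinder ((P.isBasis _).isOpen U.mem)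
  simplyConnected U := isSimplyConnected_cylinder (P.simplyConnected _ _ U.mem)
  subset_iff {U V} := cylinder_subset_cylinder_iff (P.simplyConnected _ _ U.mem).nonempty
  exists_mem_subset {y S} hS hy := by
    obtain ⟨W, hW, hyW, hWS⟩ := (P.isBasis (WithUpperSet.ofUpperSet y.proj)).exists_subset_of_mem_open
      (u := N.incl M _ ⁻¹' S) (a := y.snd) hy (hS.preimage (continuous_incl _))
    -- The cylinder starts in the fibre of `y`; an open set that contains its bottom contains all of
    -- it.
    exact ⟨⟨OrderDual.toDual _, W, hW⟩, incl_self_mem_cylinder.2 hyW,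
      cylinder_subset_of_isOpen hS hWS⟩

/-- Both points lie in the cylinder over a member of the base around `x`, and that cylinder is path
connected. -/
theorem FibreBases.joined_incl (P : N.FibreBases) {a b : K} (h : a ≤ b) (x : N.fibre a) :
    Joined (N.incl M a x) (N.incl M b (N.J h x)) := by
  obtain ⟨W, hW, hx, -⟩ := (P.isBasis a).exists_subset_of_mem_open (mem_univ x) isOpen_univ
  have hc := (isSimplyConnected_cylinder (M := M) (P.simplyConnected a W hW)).isPathConnected
  exact (hc.joinedIn _ (incl_self_mem_cylinder.2 hx) _
    (incl_mem_cylinder.2 ⟨h, x, hx, rfl⟩)).joined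

theorem FibreBases.pathConnectedSpace (P : N.FibreBases) (hK : PosetPathConnected K)
    (hN : ∀ a, PathConnectedSpace (N.fibre a)) (a₀ : K) :
    PathConnectedSpace (TotalSpace M N.tauFibre) := by
  have hfib : ∀ (a : K) (x y : N.fibre a), Joined (N.incl M a x) (N.incl M a y) := fun a x y =>
    ((hN a).joined x y).map (continuous_incl a)
  have hsimplex : ∀ {a b : K} (s : OneSimplex a b) (x : N.fibre a) (y : N.fibre b),
      Joined (N.incl M a x) (N.incl M b y) := fun s x y =>
    -- Climb to the fibre over the support, move inside it, and descend.
    (P.joined_incl s.start_le x).trans ((hfib _ _ _).trans (P.joined_incl s.end_le y).symm)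
  have hpath : ∀ {a b : K} (_ : PosetPath a b) (x : N.fibre a) (y : N.fibre b),
      Joined (N.incl M a x) (N.incl M b y) := by
    intro a b p
    induction p with
    | single s => exact hsimplex s
    | @snoc b c p s ih =>
      intro x y
      obtain ⟨z⟩ := (hN b).nonempty
      exact (ih x z).trans (hsimplex s z y)
  refine ⟨⟨N.incl M a₀ (hN a₀).nonempty.some⟩, ?_⟩
  rintro ⟨a, x⟩ ⟨b, y⟩
  obtain ⟨p⟩ := hK a b
  exact hpath p x y

end TopNetBundle

theorem theorem4p8 {K : Type u} [PartialOrder K] (hK : PosetPathConnected K)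
    (N : TopNetBundle.{u, v} K)
    (M : Type w) [TopologicalSpace M] [PathConnectedSpace M]
    (a₀ : K) (hM : Nonempty (M ≃ₜ N.fibre a₀)) :
    Nonempty (FiberBundle M N.tauFibre) ∧
    ∀ (P : N.FibreBases) (U : TopNetBundle.AssocPoset P.dual) (x : TotalSpace M N.tauFibre),
      ∃ φ : PosetPi1 U ≃* FundamentalGroup (TotalSpace M N.tauFibre) x,
        ∀ (G : Type t) [Group G],
          ∃ e : NetH1 (TopNetBundle.AssocPoset P.dual) G ≃
              HomDot (FundamentalGroup (TotalSpace M N.tauFibre) x) G,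
            ∀ z : NetCocycle (TopNetBundle.AssocPoset P.dual) G,
              e (NetH1.mk z) = HomDot.mk ((z.holonomy U).comp φ.symm.toMonoidHom) := by
  have e := fun a => (TopNetBundle.nonempty_homeomorph_fibre hK hM.some a).some
  refine ⟨TopNetBundle.nonempty_fiberBundle e, fun P U x => ?_⟩
  have : PathConnectedSpace (TotalSpace M N.tauFibre) := P.pathConnectedSpace hK
    (fun a => (e a).surjective.pathConnectedSpace (e a).continuous) a₀
  let B := P.simplyConnectedBase M
  exact ⟨B.pi1Equiv U x, fun G _ =>
    NetH1.exists_equiv_homDot B.posetPathConnected (B.pi1Equiv U x) G⟩
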